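/- Let $k$ be a field and $A$ a finite-dimensional $k$-vector space with bilinear products $\succ,\prec,\ast$. Write $x\cdot y=x\succ y+x\prec y$ and $[x,y]=x\ast y-y\ast x$. For a product $\circ$ let $L_\circ(x)y=x\circ y$ and $R_\circ(x)y=y\circ x$; let $\mathrm{ad}(x)y=[x,y]$; let $I$ be the identity and $\tau(a\otimes b)=b\otimes a$. $(A,\succ,\prec,\ast)$ is a \emph{coherent noncommutative pre-Poisson algebra} if for all $x,y,z\in A$: it is dendriform, $(x\prec y)\prec z=x\prec(y\cdot z)$, $(x\succ y)\prec z=x\succ(y\prec z)$, $x\succ(y\succ z)=(x\cdot y)\succ z$; $\ast$ is pre-Lie, $(x\ast y)\ast z-x\ast(y\ast z)=(y\ast x)\ast z-y\ast(x\ast z)$; and $$[x,y]\succ z=x\ast(y\succ z)-y\succ(x\ast z),\qquad x\prec[y,z]=y\ast(x\prec z)-(y\ast x)\prec z,$$ $$(x\cdot y)\ast z=(x\ast z)\prec y+x\succ(y\ast z),\qquad (x\cdot y)\ast z=x\ast(y\succ z)+y\ast(z\prec x).$$ A \emph{coherent noncommutative pre-Poisson coalgebra} is a space $A$ with linear maps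 $\Delta_\succ,\Delta_\prec,\delta:A\to A\otimes A$ such that, with $\Delta=\Delta_\succ+\Delta_\prec$: $(A,\Delta_\succ,\Delta_\prec)$ is a dendriform coalgebra, $$(\Delta_\succ\otimes I)\Delta_\prec=(I\otimes\Delta_\prec)\Delta_\succ,\quad (I\otimes\Delta_\succ)\Delta_\succ=(\Delta\otimes I)\Delta_\succ,\quad (\Delta_\prec\otimes I)\Delta_\prec=(I\otimes\Delta)\Delta_\prec;$$ $(A,\delta)$ is a pre-Lie coalgebra, $(I\otimes\delta)\delta-(\tau\otimes I)(I\otimes\delta)\delta=(\delta\otimes I)\delta-(\tau\otimes I)(\delta\otimes I)\delta$; and $$(\delta\otimes I)\Delta_\succ-(\tau\otimes I)(\delta\otimes I)\Delta_\succ=(I\otimes\Delta_\succ)\delta-(\tau\otimes I)(I\otimes\delta)\Delta_\succ,$$ $$(I\otimes\delta)\Delta_\prec-(I\otimes\tau)(I\otimes\delta)\Delta_\prec=(\tau\otimes I)(I\otimes\Delta_\prec)\delta-(\tau\otimes I)(\delta\otimes I)\Delta_\prec,$$ $$(\Delta\otimes I)\delta=(I\otimes\tau)(\delta\otimes I)\Delta_\prec+(I\otimes\delta)\Delta_\succ,$$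 $$(\Delta\otimes I)\delta=(I\otimes\Delta_\succ)\delta+(\tau\otimes I)(I\otimes\tau)(I\otimes\Delta_\prec)\delta.$$ $(A,\succ,\prec,\ast,\Delta_\succ,\Delta_\prec,\delta)$ is a \emph{noncommutative pre-Poisson bialgebra} if $(A,\succ,\prec,\ast)$ is a coherent noncommutative pre-Poisson algebra, $(A,\Delta_\succ,\Delta_\prec,\delta)$ is a coherent noncommutative pre-Poisson coalgebra, and for all $x,y\in A$ the following hold. (a) Dendriform bialgebra: $$\Delta_\prec(x\cdot y)=(I\otimes L_\succ(x))\Delta_\prec(y)+(R_\cdot(y)\otimes I)\Delta_\prec(x),$$ $$\Delta_\succ(x\cdot y)=(I\otimes L_\cdot(x))\Delta_\succ(y)+(R_\prec(y)\otimes I)\Delta_\succ(x),$$ $$\Delta(x\prec y)=(R_\prec(y)\otimes I)\Delta(x)+(I\otimes L_\prec(x))\Delta_\succ(y),$$ $$\Delta(x\succ y)=(I\otimes L_\succ(x))\Delta(y)+(R_\succ(y)\otimes I)\Delta_\prec(x),$$ $$(L_\cdot(x)\otimes I-I\otimes R_\prec(x))\Delta_\prec(y)+\tau\big((L_\succ(y)\otimes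 I-I\otimes R_\cdot(y))\Delta_\succ(x)\big)=0,$$ $$(L_\succ(x)\otimes I)\Delta(y)-(R_\succ(y)\otimes I)\tau\Delta_\succ(x)+(I\otimes L_\prec(y))\tau\Delta_\prec(x)-(I\otimes R_\prec(x))\Delta(y)=0.$$ (b) Pre-Lie bialgebra: $$\delta([x,y])=(I\otimes\mathrm{ad}(x)+L_\ast(x)\otimes I)\delta(y)-(I\otimes\mathrm{ad}(y)+L_\ast(y)\otimes I)\delta(x),$$ $$(\delta-\tau\delta)(x\ast y)=(L_\ast(x)\otimes I+I\otimes L_\ast(x))(\delta-\tau\delta)(y)+(I\otimes R_\ast(y))\delta(x)-(R_\ast(y)\otimes I)\tau\delta(x).$$ (c) Mixed conditions: $$\Delta(x\ast y)=(L_\ast(x)\otimes I)\Delta(y)+(I\otimes L_\ast(x))\Delta(y)-(I\otimes L_\prec(y))\delta(x)-(R_\succ(y)\otimes I)\tau\delta(x),$$ $$(\delta-\tau\delta)(y\prec x)=(I\otimes R_\prec(x))(\delta-\tau\delta)(y)+(R_\ast(y)\otimes I)\tau\Delta_\succ(x)+(I\otimes L_\prec(y))\delta(x)-(L_\ast(x)\otimes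 I)\Delta(y),$$ $$\delta(x\cdot y)=(I\otimes R_\cdot(y))\delta(x)+(I\otimes L_\cdot(x))\delta(y)-(L_\ast(x)\otimes I)\tau\Delta_\prec(y)-(L_\ast(y)\otimes I)\Delta_\succ(x),$$ $$\Delta_\prec([x,y])=(\mathrm{ad}(x)\otimes I)\Delta_\prec(y)+(I\otimes L_\succ(y))\tau\delta(x)+(I\otimes L_\ast(x))\Delta_\prec(y)-(R_\cdot(y)\otimes I)\tau\delta(x).$$ For $r=\sum_i a_i\otimes b_i\in A\otimes A$ put $$D(r)=\sum_{i,j}\big(a_i\cdot a_j\otimes b_i\otimes b_j-a_j\otimes a_i\succ b_j\otimes b_i-a_i\otimes a_j\otimes b_i\prec b_j\big),$$ $$S(r)=\sum_{i,j}\big(a_i\otimes b_i\ast a_j\otimes b_j-a_i\ast a_j\otimes b_i\otimes b_j+a_i\otimes a_j\otimes[b_i,b_j]\big),$$ that is, $D(r)=r_{12}\cdot r_{13}-r_{23}\succ r_{12}-r_{13}\prec r_{23}$ and $S(r)=r_{12}\ast r_{23}-r_{12}\ast r_{13}+[r_{13},r_{23}]$. The element $r$ is a solution of the noncommutative pre-Poisson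 Yang--Baxter equation (NPP-YBE) if $D(r)=0$ and $S(r)=0$. \textbf{Theorem.} Let $(A,\succ,\prec,\ast)$ be a coherent noncommutative pre-Poisson algebra and let $r\in A\otimes A$ be a symmetric ($\tau(r)=r$) solution of the NPP-YBE. Then $(A,\succ,\prec,\ast,\Delta_{\succ,r},\Delta_{\prec,r},\delta_r)$ is a noncommutative pre-Poisson bialgebra, where for $x\in A$ $$\Delta_{\succ,r}(x)=(I\otimes L_\cdot(x)-R_\prec(x)\otimes I)\tau(r),\qquad \Delta_{\prec,r}(x)=(R_\cdot(x)\otimes I-I\otimes L_\succ(x))r,$$ $$\delta_r(x)=(L_\ast(x)\otimes I+I\otimes\mathrm{ad}(x))r.$$ -/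

import Mathlib

open scoped TensorProduct

namespace NPPoisson

section Algebras

variable {k A : Type*} [Field k] [AddCommGroup A] [Module k A]

/-- Dendriform algebra: the products `≻` and `≺` are given as bilinear maps `s` and `p`. -/
structure IsDendriform (s p : A →ₗ[k] A →ₗ[k] A) : Prop where
  prec_prec : ∀ x y z : A, p (p x y) z = p x (s y z + p y z)
  succ_prec : ∀ x y z : A, p (s x y) z = s x (p y z)
  succ_succ : ∀ x y z : A, s x (s y z) = s (s x y + p x y) z

/-- (Left) pre-Lie algebra: the product `∗` is given as a bilinear map `t`. -/
structure IsPreLie (t : A →ₗ[k] A →ₗ[k] A) : Prop where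
  left_symm : ∀ x y z : A, t (t x y) z - t x (t y z) = t (t y x) z - t y (t x z)

/-- Noncommutative pre-Poisson algebra `(A, ≻, ≺, ∗)`, with `s = ≻`, `p = ≺`, `t = ∗`. -/
structure IsNCPrePoisson (s p t : A →ₗ[k] A →ₗ[k] A) : Prop where
  dendriform : IsDendriform s p
  preLie : IsPreLie t
  compat₁ : ∀ x y z : A, s (t x y - t y x) z = t x (s y z) - s y (t x z)
  compat₂ : ∀ x y z : A, p x (t y z - t z y) = t y (p x z) - p (t y x) z
  compat₃ : ∀ x y z : A, t (s x y + p x y) z = p (t x z) y + s x (t y z)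

/-- Coherent noncommutative pre-Poisson algebra. -/
structure IsCoherentNCPrePoisson (s p t : A →ₗ[k] A →ₗ[k] A) : Prop where
  ncPrePoisson : IsNCPrePoisson s p t
  coherent : ∀ x y z : A, t (s x y + p x y) z = t x (s y z) + t y (p z x)

/-- The commutator `[x, y] = m(x, y) - m(y, x)` of a bilinear product; `comm m x` is the
operator `ad(x)`. -/
def comm (m : A →ₗ[k] A →ₗ[k] A) : A →ₗ[k] A →ₗ[k] A := m - m.flip

end Algebras

section Coalgebras

variable {k A : Type*} [Field k] [AddCommGroup A] [Module k A]

/-- The flip `τ` of `A ⊗ A`. -/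
def tau : A ⊗[k] A →ₗ[k] A ⊗[k] A := (TensorProduct.comm k A A).toLinearMap

/-- `τ ⊗ I` on `A ⊗ A ⊗ A`: `x ⊗ y ⊗ z ↦ y ⊗ x ⊗ z`. -/
def swap12 : A ⊗[k] (A ⊗[k] A) →ₗ[k] A ⊗[k] (A ⊗[k] A) :=
  (TensorProduct.leftComm k A A A).toLinearMap

/-- `I ⊗ τ` on `A ⊗ A ⊗ A`: `x ⊗ y ⊗ z ↦ x ⊗ z ⊗ y`. -/
def swap23 : A ⊗[k] (A ⊗[k] A) →ₗ[k] A ⊗[k] (A ⊗[k] A) := LinearMap.lTensor A tau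

/-- `(Γ ⊗ I) Δ : A → A ⊗ A ⊗ A`. -/
def leftIter (Γ Δ : A →ₗ[k] A ⊗[k] A) : A →ₗ[k] A ⊗[k] (A ⊗[k] A) :=
  (TensorProduct.assoc k A A A).toLinearMap ∘ₗ LinearMap.rTensor A Γ ∘ₗ Δ

/-- `(I ⊗ Γ) Δ : A → A ⊗ A ⊗ A`. -/
def rightIter (Γ Δ : A →ₗ[k] A ⊗[k] A) : A →ₗ[k] A ⊗[k] (A ⊗[k] A) :=
  LinearMap.lTensor A Γ ∘ₗ Δ

/-- Dendriform coalgebra `(A, Δ≻, Δ≺)`, with `Ds = Δ≻`, `Dp = Δ≺`. -/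
structure IsDendriformCoalgebra (Ds Dp : A →ₗ[k] A ⊗[k] A) : Prop where
  coassoc₁ : leftIter Ds Dp = rightIter Dp Ds
  coassoc₂ : rightIter Ds Ds = leftIter (Ds + Dp) Ds
  coassoc₃ : leftIter Dp Dp = rightIter (Ds + Dp) Dp

/-- Pre-Lie coalgebra `(A, δ)`, with `d = δ`. -/
structure IsPreLieCoalgebra (d : A →ₗ[k] A ⊗[k] A) : Prop where
  left_cosymm : rightIter d d - swap12 ∘ₗ rightIter d d = leftIter d d - swap12 ∘ₗ leftIter d d

/-- Noncommutative pre-Poisson coalgebra `(A, Δ≻, Δ≺, δ)`. -/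
structure IsNCPrePoissonCoalgebra (Ds Dp d : A →ₗ[k] A ⊗[k] A) : Prop where
  dendriform : IsDendriformCoalgebra Ds Dp
  preLie : IsPreLieCoalgebra d
  compat₁ : leftIter d Ds - swap12 ∘ₗ leftIter d Ds = rightIter Ds d - swap12 ∘ₗ rightIter d Ds
  compat₂ : rightIter d Dp - swap23 ∘ₗ rightIter d Dp
    = swap12 ∘ₗ rightIter Dp d - swap12 ∘ₗ leftIter d Dp
  compat₃ : leftIter Ds d + leftIter Dp d = swap23 ∘ₗ leftIter d Dp + rightIter d Ds

/-- Coherent noncommutative pre-Poisson coalgebra. -/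
structure IsCoherentNCPrePoissonCoalgebra (Ds Dp d : A →ₗ[k] A ⊗[k] A) : Prop where
  ncPrePoisson : IsNCPrePoissonCoalgebra Ds Dp d
  coherent : leftIter (Ds + Dp) d = rightIter Ds d + swap12 ∘ₗ swap23 ∘ₗ rightIter Dp d

end Coalgebras

section Bialgebras

variable {k A : Type*} [Field k] [AddCommGroup A] [Module k A]

/-- `f ⊗ I` on `A ⊗ A`. -/
abbrev onFst (f : A →ₗ[k] A) : A ⊗[k] A →ₗ[k] A ⊗[k] A := LinearMap.rTensor A f

/-- `I ⊗ f` on `A ⊗ A`. -/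
abbrev onSnd (f : A →ₗ[k] A) : A ⊗[k] A →ₗ[k] A ⊗[k] A := LinearMap.lTensor A f

/-- Dendriform bialgebra. The operator of left multiplication by `x` for a product `m` is `m x`,
that of right multiplication is `m.flip x`; the associative product is `· = ≻ + ≺ = s + p`, and
`Δ = Δ≻ + Δ≺ = Ds + Dp`. -/
structure IsDendriformBialgebra (s p : A →ₗ[k] A →ₗ[k] A) (Ds Dp : A →ₗ[k] A ⊗[k] A) : Prop where
  algebra : IsDendriform s p
  coalgebra : IsDendriformCoalgebra Ds Dp
  compat₁ : ∀ x y : A,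
    Dp ((s + p) x y) = onSnd (s x) (Dp y) + onFst ((s + p).flip y) (Dp x)
  compat₂ : ∀ x y : A,
    Ds ((s + p) x y) = onSnd ((s + p) x) (Ds y) + onFst (p.flip y) (Ds x)
  compat₃ : ∀ x y : A,
    (Ds + Dp) (p x y) = onFst (p.flip y) ((Ds + Dp) x) + onSnd (p x) (Ds y)
  compat₄ : ∀ x y : A,
    (Ds + Dp) (s x y) = onSnd (s x) ((Ds + Dp) y) + onFst (s.flip y) (Dp x)
  compat₅ : ∀ x y : A,
    (onFst ((s + p) x) - onSnd (p.flip x)) (Dp y)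
      + tau ((onFst (s y) - onSnd ((s + p).flip y)) (Ds x)) = 0
  compat₆ : ∀ x y : A,
    onFst (s x) ((Ds + Dp) y) - onFst (s.flip y) (tau (Ds x))
      + onSnd (p y) (tau (Dp x)) - onSnd (p.flip x) ((Ds + Dp) y) = 0

/-- Pre-Lie bialgebra. -/
structure IsPreLieBialgebra (t : A →ₗ[k] A →ₗ[k] A) (d : A →ₗ[k] A ⊗[k] A) : Prop where
  algebra : IsPreLie t
  coalgebra : IsPreLieCoalgebra d
  compat₁ : ∀ x y : A,
    d (t x y - t y x) = (onSnd (comm t x) + onFst (t x)) (d y) - (onSnd (comm t y) + onFst (t y)) (d x)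
  compat₂ : ∀ x y : A,
    (d - tau ∘ₗ d) (t x y) = (onFst (t x) + onSnd (t x)) ((d - tau ∘ₗ d) y)
      + onSnd (t.flip y) (d x) - onFst (t.flip y) (tau (d x))

/-- Noncommutative pre-Poisson bialgebra `(A, ≻, ≺, ∗, Δ≻, Δ≺, δ)`. -/
structure IsNCPrePoissonBialgebra (s p t : A →ₗ[k] A →ₗ[k] A)
    (Ds Dp d : A →ₗ[k] A ⊗[k] A) : Prop where
  algebra : IsCoherentNCPrePoisson s p t
  coalgebra : IsCoherentNCPrePoissonCoalgebra Ds Dp d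
  dendriform : IsDendriformBialgebra s p Ds Dp
  preLie : IsPreLieBialgebra t d
  compat₁ : ∀ x y : A,
    (Ds + Dp) (t x y) = onFst (t x) ((Ds + Dp) y) + onSnd (t x) ((Ds + Dp) y)
      - onSnd (p y) (d x) - onFst (s.flip y) (tau (d x))
  compat₂ : ∀ x y : A,
    (d - tau ∘ₗ d) (p y x) = onSnd (p.flip x) ((d - tau ∘ₗ d) y) + onFst (t.flip y) (tau (Ds x))
      + onSnd (p y) (d x) - onFst (t x) ((Ds + Dp) y)
  compat₃ : ∀ x y : A,
    d ((s + p) x y) = onSnd ((s + p).flip y) (d x) + onSnd ((s + p) x) (d y)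
      - onFst (t x) (tau (Dp y)) - onFst (t y) (Ds x)
  compat₄ : ∀ x y : A,
    Dp (t x y - t y x) = onFst (comm t x) (Dp y) + onSnd (s y) (tau (d x))
      + onSnd (t x) (Dp y) - onFst ((s + p).flip y) (tau (d x))

end Bialgebras

section YangBaxter

variable {k A : Type*} [Field k] [AddCommGroup A] [Module k A]

/-- `r₁₂ m r'₁₃`, bilinear in `r, r'`. -/
def leg12_13 (m : A →ₗ[k] A →ₗ[k] A) :
    A ⊗[k] A →ₗ[k] A ⊗[k] A →ₗ[k] A ⊗[k] (A ⊗[k] A) :=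
  (TensorProduct.mk k (A ⊗[k] A) (A ⊗[k] A)).compr₂
    (LinearMap.rTensor (A ⊗[k] A) (TensorProduct.lift m)
      ∘ₗ (TensorProduct.tensorTensorTensorComm k A A A A).toLinearMap)

/-- `r₁₃ m r'₂₃`, bilinear in `r, r'`. -/
def leg13_23 (m : A →ₗ[k] A →ₗ[k] A) :
    A ⊗[k] A →ₗ[k] A ⊗[k] A →ₗ[k] A ⊗[k] (A ⊗[k] A) :=
  (TensorProduct.mk k (A ⊗[k] A) (A ⊗[k] A)).compr₂
    ((TensorProduct.assoc k A A A).toLinearMap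
      ∘ₗ LinearMap.lTensor (A ⊗[k] A) (TensorProduct.lift m)
      ∘ₗ (TensorProduct.tensorTensorTensorComm k A A A A).toLinearMap)

/-- `r₁₂ m r'₂₃`, bilinear in `r, r'`. -/
def leg12_23 (m : A →ₗ[k] A →ₗ[k] A) :
    A ⊗[k] A →ₗ[k] A ⊗[k] A →ₗ[k] A ⊗[k] (A ⊗[k] A) :=
  (TensorProduct.mk k (A ⊗[k] A) (A ⊗[k] A)).compr₂
    (LinearMap.lTensor A
        (LinearMap.rTensor A (TensorProduct.lift m) ∘ₗ (TensorProduct.assoc k A A A).symm.toLinearMap)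
      ∘ₗ (TensorProduct.assoc k A A (A ⊗[k] A)).toLinearMap)

/-- `r₂₃ m r'₁₂`, bilinear in `r, r'`. -/
def leg23_12 (m : A →ₗ[k] A →ₗ[k] A) :
    A ⊗[k] A →ₗ[k] A ⊗[k] A →ₗ[k] A ⊗[k] (A ⊗[k] A) :=
  (leg12_23 m.flip).flip

theorem leg12_13_tmul (m : A →ₗ[k] A →ₗ[k] A) (a b a' b' : A) :
    leg12_13 m (a ⊗ₜ[k] b) (a' ⊗ₜ[k] b') = m a a' ⊗ₜ[k] (b ⊗ₜ[k] b') := by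
  simp [leg12_13]

theorem leg13_23_tmul (m : A →ₗ[k] A →ₗ[k] A) (a b a' b' : A) :
    leg13_23 m (a ⊗ₜ[k] b) (a' ⊗ₜ[k] b') = a ⊗ₜ[k] (a' ⊗ₜ[k] m b b') := by
  simp [leg13_23]

theorem leg12_23_tmul (m : A →ₗ[k] A →ₗ[k] A) (a b a' b' : A) :
    leg12_23 m (a ⊗ₜ[k] b) (a' ⊗ₜ[k] b') = a ⊗ₜ[k] (m b a' ⊗ₜ[k] b') := by
  simp [leg12_23]

theorem leg23_12_tmul (m : A →ₗ[k] A →ₗ[k] A) (a b a' b' : A) :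
    leg23_12 m (a ⊗ₜ[k] b) (a' ⊗ₜ[k] b') = a' ⊗ₜ[k] (m a b' ⊗ₜ[k] b) := by
  simp [leg23_12, leg12_23_tmul]

/-- `D(r) = r₁₂ · r₁₃ - r₂₃ ≻ r₁₂ - r₁₃ ≺ r₂₃`. -/
def dExpr (s p : A →ₗ[k] A →ₗ[k] A) (r : A ⊗[k] A) : A ⊗[k] (A ⊗[k] A) :=
  leg12_13 (s + p) r r - leg23_12 s r r - leg13_23 p r r

/-- `S(r) = r₁₂ ∗ r₂₃ - r₁₂ ∗ r₁₃ + [r₁₃, r₂₃]`. -/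
def sExpr (t : A →ₗ[k] A →ₗ[k] A) (r : A ⊗[k] A) : A ⊗[k] (A ⊗[k] A) :=
  leg12_23 t r r - leg12_13 t r r + leg13_23 (comm t) r r

/-- `r` is a solution of the noncommutative pre-Poisson Yang-Baxter equation. -/
structure IsNPPYBESolution (s p t : A →ₗ[k] A →ₗ[k] A) (r : A ⊗[k] A) : Prop where
  d_eq : dExpr s p r = 0
  s_eq : sExpr t r = 0

/-- `Δ≻,r(x) = (I ⊗ L·(x) - R≺(x) ⊗ I) τ(r)`. -/
def coboundarySucc (s p : A →ₗ[k] A →ₗ[k] A) (r : A ⊗[k] A) : A →ₗ[k] A ⊗[k] A where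
  toFun x := (onSnd ((s + p) x) - onFst (p.flip x)) (tau r)
  map_add' x y := by
    simp only [onSnd, onFst, map_add, LinearMap.lTensor_add, LinearMap.rTensor_add,
      LinearMap.add_apply, LinearMap.sub_apply]
    abel
  map_smul' c x := by
    simp only [onSnd, onFst, map_smul, LinearMap.lTensor_smul, LinearMap.rTensor_smul,
      LinearMap.smul_apply, LinearMap.sub_apply, RingHom.id_apply, smul_sub]

/-- `Δ≺,r(x) = (R·(x) ⊗ I - I ⊗ L≻(x)) r`. -/
def coboundaryPrec (s p : A →ₗ[k] A →ₗ[k] A) (r : A ⊗[k] A) : A →ₗ[k] A ⊗[k] A where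
  toFun x := (onFst ((s + p).flip x) - onSnd (s x)) r
  map_add' x y := by
    simp only [onSnd, onFst, map_add, LinearMap.lTensor_add, LinearMap.rTensor_add,
      LinearMap.add_apply, LinearMap.sub_apply]
    abel
  map_smul' c x := by
    simp only [onSnd, onFst, map_smul, LinearMap.lTensor_smul, LinearMap.rTensor_smul,
      LinearMap.smul_apply, LinearMap.sub_apply, RingHom.id_apply, smul_sub]

/-- `δ_r(x) = (L∗(x) ⊗ I + I ⊗ ad(x)) r`. -/
def coboundaryStar (t : A →ₗ[k] A →ₗ[k] A) (r : A ⊗[k] A) : A →ₗ[k] A ⊗[k] A where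
  toFun x := (onFst (t x) + onSnd (comm t x)) r
  map_add' x y := by
    simp only [onSnd, onFst, map_add, LinearMap.lTensor_add, LinearMap.rTensor_add,
      LinearMap.add_apply]
    abel
  map_smul' c x := by
    simp only [onSnd, onFst, map_smul, LinearMap.lTensor_smul, LinearMap.rTensor_smul,
      LinearMap.smul_apply, LinearMap.add_apply, RingHom.id_apply, smul_add]

end YangBaxter

end NPPoisson

set_option linter.unusedSimpArgs false

/-! The two halves of the theorem use the hypotheses differently. The compatibility conditions (a),
(b), (c) are linear in `r`, and symmetry removes every flip of `r` from them. What remains holds on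
any pure tensor `a ⊗ b`: it is a signed sum of algebra axioms, each placed in one leg while the
other leg is inert. The Yang-Baxter equation plays no part there.

It is needed for the coalgebra axioms, which are quadratic in `r`. By `leftIter_cob` and
`rightIter_cob`, an iterated coproduct of `x` is a combination of products of two copies of `r` that
meet in one of three legs. Either `x` enters the product in the shared leg, or it acts as an
operator on a leg outside it. The terms of the second kind are traded by applying the same operators
to `D(r) = 0`, `S(r) = 0` and their leg permutations; the algebra axioms, read in the shared leg,
cancel the rest. `D` alone serves the dendriform and coherence axioms, `S` alone the pre-Lie axiom,
and the three remaining compatibilities use both. -/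

namespace NPPoisson

/-! ### Coboundaries of a symmetric tensor and the flip. -/

section FirstOrder

variable {k A : Type*} [Field k] [AddCommGroup A] [Module k A]

theorem tau_onFst (f : A →ₗ[k] A) (z : A ⊗[k] A) : tau (onFst f z) = onSnd f (tau z) := by
  induction z with
  | zero => simp
  | tmul a b => simp [tau]
  | add z w hz hw => simp only [map_add, hz, hw]

theorem tau_onSnd (f : A →ₗ[k] A) (z : A ⊗[k] A) : tau (onSnd f z) = onFst f (tau z) := by
  induction z with
  | zero => simp
  | tmul a b => simp [tau]
  | add z w hz hw => simp only [map_add, hz, hw]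

theorem coboundarySucc_apply {s p : A →ₗ[k] A →ₗ[k] A} {r : A ⊗[k] A} (hsymm : tau r = r)
    (x : A) : coboundarySucc s p r x = onSnd ((s + p) x) r - onFst (p.flip x) r := by
  change (onSnd ((s + p) x) - onFst (p.flip x)) (tau r) = _
  rw [hsymm, LinearMap.sub_apply]

theorem coboundaryPrec_apply (s p : A →ₗ[k] A →ₗ[k] A) (r : A ⊗[k] A) (x : A) :
    coboundaryPrec s p r x = onFst ((s + p).flip x) r - onSnd (s x) r := rfl

theorem coboundaryStar_apply (t : A →ₗ[k] A →ₗ[k] A) (r : A ⊗[k] A) (x : A) :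
    coboundaryStar t r x = onFst (t x) r + onSnd (comm t x) r := rfl

variable (k)

theorem tmul_congr_left {u v : A} (h : u = v) (b : A) : u ⊗ₜ[k] b = v ⊗ₜ[k] b := by rw [h]

theorem tmul_congr_right {u v : A} (a : A) (h : u = v) : a ⊗ₜ[k] u = a ⊗ₜ[k] v := by rw [h]

end FirstOrder

/-! ### Iterated coboundaries as products of two copies of `r`. -/

section SecondOrder

variable {k A : Type*} [Field k] [AddCommGroup A] [Module k A]

/-- `x ↦ (F(x) ⊗ I) r`. -/
def cobFst (F : A →ₗ[k] A →ₗ[k] A) (r : A ⊗[k] A) : A →ₗ[k] A ⊗[k] A :=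
  (LinearMap.rTensorHom A ∘ₗ F).flip r

/-- `x ↦ (I ⊗ F(x)) r`. -/
def cobSnd (F : A →ₗ[k] A →ₗ[k] A) (r : A ⊗[k] A) : A →ₗ[k] A ⊗[k] A :=
  (LinearMap.lTensorHom A ∘ₗ F).flip r

theorem cobFst_apply (F : A →ₗ[k] A →ₗ[k] A) (r : A ⊗[k] A) (x : A) :
    cobFst F r x = onFst (F x) r := rfl

theorem cobSnd_apply (F : A →ₗ[k] A →ₗ[k] A) (r : A ⊗[k] A) (x : A) :
    cobSnd F r x = onSnd (F x) r := rfl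

/-- `f` acting on the first factor of `A ⊗ A ⊗ A`. -/
abbrev onLeg₁ (f : A →ₗ[k] A) : A ⊗[k] (A ⊗[k] A) →ₗ[k] A ⊗[k] (A ⊗[k] A) :=
  LinearMap.rTensor (A ⊗[k] A) f

/-- `f` acting on the second factor of `A ⊗ A ⊗ A`. -/
abbrev onLeg₂ (f : A →ₗ[k] A) : A ⊗[k] (A ⊗[k] A) →ₗ[k] A ⊗[k] (A ⊗[k] A) :=
  LinearMap.lTensor A (LinearMap.rTensor A f)

/-- `f` acting on the third factor of `A ⊗ A ⊗ A`. -/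
abbrev onLeg₃ (f : A →ₗ[k] A) : A ⊗[k] (A ⊗[k] A) →ₗ[k] A ⊗[k] (A ⊗[k] A) :=
  LinearMap.lTensor A (LinearMap.lTensor A f)

section Iterates

variable (F G : A →ₗ[k] A →ₗ[k] A) (r r' : A ⊗[k] A) (x : A)

/-- If the outer map moves the first factor, `G x` lands inside the argument of the inner map and
composes with `F`. If it moves the second factor, that factor becomes leg 3, which the inner map
never touches, so `G x` factors out. -/
theorem leftIter_cob :
    leftIter (cobFst F r') (cobFst G r) x = leg12_13 (F ∘ₗ G x).flip r' r ∧
    leftIter (cobSnd F r') (cobFst G r) x = leg12_23 (F ∘ₗ G x).flip r' r ∧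
    leftIter (cobFst F r') (cobSnd G r) x = onLeg₃ (G x) (leg12_13 F.flip r' r) ∧
    leftIter (cobSnd F r') (cobSnd G r) x = onLeg₃ (G x) (leg12_23 F.flip r' r) := by
  simp only [leftIter, LinearMap.comp_apply, cobFst_apply, cobSnd_apply]
  refine ⟨?_, ?_, ?_, ?_⟩
  all_goals
    induction r with
    | zero => simp
    | add z w hz hw => simp only [map_add, hz, hw]
    | tmul a b =>
      simp only [onFst, onSnd, LinearMap.rTensor_tmul, LinearMap.lTensor_tmul, cobFst_apply,
        cobSnd_apply]
      induction r' with
      | zero => simp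
      | add z w hz hw => simp only [map_add, TensorProduct.add_tmul, LinearMap.add_apply, hz, hw]
      | tmul c d => simp [leg12_13_tmul, leg12_23_tmul]

theorem rightIter_cob :
    rightIter (cobFst F r') (cobFst G r) x = onLeg₁ (G x) (leg12_23 F r r') ∧
    rightIter (cobSnd F r') (cobFst G r) x = onLeg₁ (G x) (leg13_23 F r r') ∧
    rightIter (cobFst F r') (cobSnd G r) x = leg12_23 (F ∘ₗ G x) r r' ∧
    rightIter (cobSnd F r') (cobSnd G r) x = leg13_23 (F ∘ₗ G x) r r' := by
  simp only [rightIter, LinearMap.comp_apply, cobFst_apply, cobSnd_apply]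
  refine ⟨?_, ?_, ?_, ?_⟩
  all_goals
    induction r with
    | zero => simp
    | add z w hz hw => simp only [map_add, LinearMap.add_apply, hz, hw]
    | tmul a b =>
      simp only [onFst, onSnd, LinearMap.rTensor_tmul, LinearMap.lTensor_tmul, cobFst_apply,
        cobSnd_apply]
      induction r' with
      | zero => simp
      | add z w hz hw => simp only [map_add, TensorProduct.tmul_add, hz, hw]
      | tmul c d => simp [leg12_23_tmul, leg13_23_tmul]

end Iterates

section IterLinear

variable (Γ Γ' Δ Δ' : A →ₗ[k] A ⊗[k] A) (x : A)

theorem leftIter_add_left : leftIter (Γ + Γ') Δ x = leftIter Γ Δ x + leftIter Γ' Δ x := by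
  simp [leftIter, LinearMap.rTensor_add]

theorem leftIter_sub_left : leftIter (Γ - Γ') Δ x = leftIter Γ Δ x - leftIter Γ' Δ x := by
  simp [leftIter, LinearMap.rTensor_sub]

theorem leftIter_add_right : leftIter Γ (Δ + Δ') x = leftIter Γ Δ x + leftIter Γ Δ' x := by
  simp [leftIter]

theorem leftIter_sub_right : leftIter Γ (Δ - Δ') x = leftIter Γ Δ x - leftIter Γ Δ' x := by
  simp [leftIter]

theorem rightIter_add_left : rightIter (Γ + Γ') Δ x = rightIter Γ Δ x + rightIter Γ' Δ x := by
  simp [rightIter, LinearMap.lTensor_add]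

theorem rightIter_sub_left : rightIter (Γ - Γ') Δ x = rightIter Γ Δ x - rightIter Γ' Δ x := by
  simp [rightIter, LinearMap.lTensor_sub]

theorem rightIter_add_right : rightIter Γ (Δ + Δ') x = rightIter Γ Δ x + rightIter Γ Δ' x := by
  simp [rightIter]

theorem rightIter_sub_right : rightIter Γ (Δ - Δ') x = rightIter Γ Δ x - rightIter Γ Δ' x := by
  simp [rightIter]

end IterLinear

/-! ### Leg permutations. -/

section Swaps

theorem swap12_tmul (a b c : A) : swap12 (k := k) (a ⊗ₜ (b ⊗ₜ c)) = b ⊗ₜ (a ⊗ₜ c) := rfl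

theorem swap23_tmul (a b c : A) : swap23 (k := k) (a ⊗ₜ (b ⊗ₜ c)) = a ⊗ₜ (c ⊗ₜ b) := rfl

variable (f : A →ₗ[k] A)

theorem swap12_onLeg (z : A ⊗[k] (A ⊗[k] A)) :
    swap12 (onLeg₁ f z) = onLeg₂ f (swap12 z) ∧ swap12 (onLeg₂ f z) = onLeg₁ f (swap12 z) ∧
      swap12 (onLeg₃ f z) = onLeg₃ f (swap12 z) := by
  simp only [← LinearMap.comp_apply]
  refine ⟨LinearMap.congr_fun ?_ z, LinearMap.congr_fun ?_ z, LinearMap.congr_fun ?_ z⟩ <;>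
    exact TensorProduct.ext_threefold' fun _ _ _ => rfl

theorem swap23_onLeg (z : A ⊗[k] (A ⊗[k] A)) :
    swap23 (onLeg₁ f z) = onLeg₁ f (swap23 z) ∧ swap23 (onLeg₂ f z) = onLeg₃ f (swap23 z) ∧
      swap23 (onLeg₃ f z) = onLeg₂ f (swap23 z) := by
  simp only [← LinearMap.comp_apply]
  refine ⟨LinearMap.congr_fun ?_ z, LinearMap.congr_fun ?_ z, LinearMap.congr_fun ?_ z⟩ <;>
    exact TensorProduct.ext_threefold' fun _ _ _ => rfl

variable (m : A →ₗ[k] A →ₗ[k] A) (z w : A ⊗[k] A)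

/-- This and the next five lemmas show that, for symmetric tensors, the three leg shapes are closed
under permutations, so permuted `D` and `S` can be compared with the originals. -/
theorem swap12_leg12_13 : swap12 (leg12_13 m z w) = leg12_23 m (tau z) w := by
  suffices h : (leg12_13 m).compr₂ swap12 = (leg12_23 m) ∘ₗ tau from
    LinearMap.congr_fun₂ h z w
  ext a b c d
  simp [leg12_13_tmul, leg12_23_tmul, swap12_tmul, tau]

theorem swap12_leg12_23 : swap12 (leg12_23 m z w) = leg12_13 m (tau z) w := by
  suffices h : (leg12_23 m).compr₂ swap12 = (leg12_13 m) ∘ₗ tau from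
    LinearMap.congr_fun₂ h z w
  ext a b c d
  simp [leg12_13_tmul, leg12_23_tmul, swap12_tmul, tau]

theorem swap12_leg13_23 : swap12 (leg13_23 m z w) = leg13_23 m.flip w z := by
  suffices h : (leg13_23 m).compr₂ swap12 = (leg13_23 m.flip).flip from
    LinearMap.congr_fun₂ h z w
  ext a b c d
  simp [leg13_23_tmul, swap12_tmul]

theorem swap23_leg12_13 : swap23 (leg12_13 m z w) = leg12_13 m.flip w z := by
  suffices h : (leg12_13 m).compr₂ swap23 = (leg12_13 m.flip).flip from
    LinearMap.congr_fun₂ h z w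
  ext a b c d
  simp [leg12_13_tmul, swap23_tmul]

theorem swap23_leg12_23 : swap23 (leg12_23 m z w) = leg13_23 m z (tau w) := by
  suffices h : (leg12_23 m).compr₂ swap23 = (leg13_23 m).compl₂ tau from
    LinearMap.congr_fun₂ h z w
  ext a b c d
  simp [leg12_23_tmul, leg13_23_tmul, swap23_tmul, tau]

theorem swap23_leg13_23 : swap23 (leg13_23 m z w) = leg12_23 m z (tau w) := by
  suffices h : (leg13_23 m).compr₂ swap23 = (leg12_23 m).compl₂ tau from
    LinearMap.congr_fun₂ h z w
  ext a b c d
  simp [leg12_23_tmul, leg13_23_tmul, swap23_tmul, tau]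

end Swaps

end SecondOrder

section Coboundary

variable {k A : Type*} [Field k] [AddCommGroup A] [Module k A]

/-! ### Double-sum normal forms. -/

section Sums

variable (S : Finset (A × A)) (m : A →ₗ[k] A →ₗ[k] A) {F G : A → A → A}

/-- The order of summation is fixed once for all three shapes, so that equal terms become identical
atoms for `module`. -/
theorem leg12_13_sum :
    leg12_13 m (∑ i ∈ S, i.1 ⊗ₜ[k] i.2) (∑ i ∈ S, i.1 ⊗ₜ[k] i.2)
      = ∑ i ∈ S, ∑ j ∈ S, m i.1 j.1 ⊗ₜ[k] (i.2 ⊗ₜ[k] j.2) := by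
  simp only [map_sum, LinearMap.sum_apply, leg12_13_tmul]
  exact Finset.sum_comm

theorem leg12_23_sum :
    leg12_23 m (∑ i ∈ S, i.1 ⊗ₜ[k] i.2) (∑ i ∈ S, i.1 ⊗ₜ[k] i.2)
      = ∑ i ∈ S, ∑ j ∈ S, i.1 ⊗ₜ[k] (m i.2 j.1 ⊗ₜ[k] j.2) := by
  simp only [map_sum, LinearMap.sum_apply, leg12_23_tmul]
  exact Finset.sum_comm

theorem leg13_23_sum :
    leg13_23 m (∑ i ∈ S, i.1 ⊗ₜ[k] i.2) (∑ i ∈ S, i.1 ⊗ₜ[k] i.2)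
      = ∑ i ∈ S, ∑ j ∈ S, i.1 ⊗ₜ[k] (j.1 ⊗ₜ[k] m i.2 j.2) := by
  simp only [map_sum, LinearMap.sum_apply, leg13_23_tmul]
  exact Finset.sum_comm

variable (k)

/-- Inserts an algebra axiom into the leg where the two copies of `r` meet. -/
theorem sum_leg₁_congr (h : ∀ u v, F u v = G u v) :
    ∑ i ∈ S, ∑ j ∈ S, F i.1 j.1 ⊗ₜ[k] (i.2 ⊗ₜ[k] j.2)
      = ∑ i ∈ S, ∑ j ∈ S, G i.1 j.1 ⊗ₜ[k] (i.2 ⊗ₜ[k] j.2) := by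
  simp only [h]

theorem sum_leg₂_congr (h : ∀ u v, F u v = G u v) :
    ∑ i ∈ S, ∑ j ∈ S, i.1 ⊗ₜ[k] (F i.2 j.1 ⊗ₜ[k] j.2)
      = ∑ i ∈ S, ∑ j ∈ S, i.1 ⊗ₜ[k] (G i.2 j.1 ⊗ₜ[k] j.2) := by
  simp only [h]

theorem sum_leg₃_congr (h : ∀ u v, F u v = G u v) :
    ∑ i ∈ S, ∑ j ∈ S, i.1 ⊗ₜ[k] (j.1 ⊗ₜ[k] F i.2 j.2)
      = ∑ i ∈ S, ∑ j ∈ S, i.1 ⊗ₜ[k] (j.1 ⊗ₜ[k] G i.2 j.2) := by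
  simp only [h]

end Sums

theorem coboundarySucc_eq {s p : A →ₗ[k] A →ₗ[k] A} {r : A ⊗[k] A} (hsymm : tau r = r) :
    coboundarySucc s p r = cobSnd (s + p) r - cobFst p.flip r :=
  LinearMap.ext fun x => coboundarySucc_apply hsymm x

theorem coboundaryPrec_eq (s p : A →ₗ[k] A →ₗ[k] A) (r : A ⊗[k] A) :
    coboundaryPrec s p r = cobFst (s + p).flip r - cobSnd s r := rfl

theorem coboundaryStar_eq (t : A →ₗ[k] A →ₗ[k] A) (r : A ⊗[k] A) :
    coboundaryStar t r = cobFst t r + cobSnd (comm t) r := rfl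

variable {s p t : A →ₗ[k] A →ₗ[k] A} {r : A ⊗[k] A}

/-! ### Coalgebra axioms, from the Yang-Baxter equation. -/

set_option maxHeartbeats 2000000 in
theorem coboundary_isCoherentNCPrePoissonCoalgebra (h : IsCoherentNCPrePoisson s p t)
    (hsymm : tau r = r) (hD : dExpr s p r = 0) (hS : sExpr t r = 0) :
    IsCoherentNCPrePoissonCoalgebra (coboundarySucc s p r) (coboundaryPrec s p r)
      (coboundaryStar t r) := by
  have hd := h.ncPrePoisson.dendriform
  have hl := h.ncPrePoisson.preLie
  obtain ⟨S, hr⟩ := TensorProduct.exists_finset r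
  -- The subscript records the permutation: here `x ⊗ y ⊗ z` goes to `y ⊗ z ⊗ x`.
  have hD₂₃₁ := DFunLike.congr_arg (swap23 ∘ₗ swap12) hD
  have hD₁₃₂ := DFunLike.congr_arg swap23 hD
  have hS₁₃₂ := DFunLike.congr_arg swap23 hS
  refine ⟨⟨⟨?_, ?_, ?_⟩, ⟨?_⟩, ?_, ?_, ?_⟩, ?_⟩ <;> ext1 x
  -- In every case the operators applied to `D` and `S` are those by which the outer coproduct acts
  -- on a leg outside the shared one; the axioms listed after them settle the terms with `x` in the
  -- shared leg.
  on_goal 1 =>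
    linear_combination (norm := skip)
      DFunLike.congr_arg (onLeg₃ (s x)) hD₂₃₁
      + DFunLike.congr_arg (onLeg₃ (s x)) hD
      - DFunLike.congr_arg (onLeg₁ (p.flip x)) hD₂₃₁
      - DFunLike.congr_arg (onLeg₁ (p.flip x)) hD
      + sum_leg₂_congr k S (fun u v => hd.succ_prec v x u)
      + sum_leg₁_congr k S (fun u v => hd.prec_prec u v x)
      - sum_leg₂_congr k S (fun u v => hd.succ_succ v x u)
      + sum_leg₂_congr k S (fun u v => hd.prec_prec v x u)
      - sum_leg₃_congr k S (fun u v => hd.succ_succ x u v)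
  on_goal 2 =>
    linear_combination (norm := skip)
      DFunLike.congr_arg (onLeg₃ (s x)) hD₂₃₁
      + DFunLike.congr_arg (onLeg₃ (p x)) hD₂₃₁
      - DFunLike.congr_arg (onLeg₁ (p.flip x)) hD₂₃₁
      + sum_leg₃_congr k S (fun u v => hd.succ_prec x u v)
      - sum_leg₃_congr k S (fun u v => hd.succ_succ x u v)
      + sum_leg₃_congr k S (fun u v => hd.prec_prec x u v)
      + sum_leg₂_congr k S (fun u v => hd.prec_prec v x u)
      - sum_leg₁_congr k S (fun u v => hd.succ_prec u v x)
  on_goal 3 =>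
    linear_combination (norm := skip)
      DFunLike.congr_arg (onLeg₁ (s.flip x)) hD
      + DFunLike.congr_arg (onLeg₁ (p.flip x)) hD
      - DFunLike.congr_arg (onLeg₃ (s x)) hD
      + sum_leg₁_congr k S (fun u v => hd.succ_succ u v x)
      - sum_leg₁_congr k S (fun u v => hd.prec_prec u v x)
      - sum_leg₁_congr k S (fun u v => hd.succ_prec u v x)
      + sum_leg₂_congr k S (fun u v => hd.succ_succ v x u)
      + sum_leg₃_congr k S (fun u v => hd.succ_prec x u v)
  on_goal 4 =>
    linear_combination (norm := skip)
      DFunLike.congr_arg (onLeg₁ (t x)) hS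
      + DFunLike.congr_arg (onLeg₃ (t x)) hS
      + DFunLike.congr_arg (onLeg₂ (t x)) hS
      - DFunLike.congr_arg (onLeg₃ (t.flip x)) hS
      + sum_leg₃_congr k S (fun u v => hl.left_symm v x u)
      - sum_leg₃_congr k S (fun u v => hl.left_symm u x v)
      + sum_leg₃_congr k S (fun u v => hl.left_symm u v x)
      - sum_leg₂_congr k S (fun u v => hl.left_symm u x v)
      + sum_leg₁_congr k S (fun u v => hl.left_symm u x v)
  on_goal 5 =>
    linear_combination (norm := skip)
      -DFunLike.congr_arg (onLeg₁ (t x)) hD₂₃₁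
      - DFunLike.congr_arg (onLeg₃ (s x)) hS
      - DFunLike.congr_arg (onLeg₃ (p x)) hS
      + DFunLike.congr_arg (onLeg₂ (p.flip x)) hS
      + sum_leg₁_congr k S (fun u v => h.coherent x u v)
      + sum_leg₃_congr k S (fun u v => h.ncPrePoisson.compat₃ x v u)
      + sum_leg₃_congr k S (fun u v => h.ncPrePoisson.compat₂ x u v)
      - sum_leg₂_congr k S (fun u v => h.ncPrePoisson.compat₂ v u x)
      + sum_leg₃_congr k S (fun u v => h.ncPrePoisson.compat₁ u x v)
  on_goal 6 =>
    linear_combination (norm := skip)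
      -DFunLike.congr_arg (onLeg₁ (s.flip x)) hS₁₃₂
      + DFunLike.congr_arg (onLeg₁ (s.flip x)) hS
      - DFunLike.congr_arg (onLeg₁ (p.flip x)) hS₁₃₂
      + DFunLike.congr_arg (onLeg₁ (p.flip x)) hS
      - DFunLike.congr_arg (onLeg₂ (t x)) hD₁₃₂
      + DFunLike.congr_arg (onLeg₃ (s x)) hS₁₃₂
      - DFunLike.congr_arg (onLeg₃ (s x)) hS
      + sum_leg₁_congr k S (fun u v => h.ncPrePoisson.compat₃ v x u)
      - sum_leg₃_congr k S (fun u v => h.ncPrePoisson.compat₁ v x u)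
      - sum_leg₂_congr k S (fun u v => h.coherent x v u)
      + sum_leg₂_congr k S (fun u v => h.ncPrePoisson.compat₃ v x u)
      + sum_leg₂_congr k S (fun u v => h.ncPrePoisson.compat₂ u v x)
      + sum_leg₂_congr k S (fun u v => h.ncPrePoisson.compat₂ u x v)
      + sum_leg₂_congr k S (fun u v => h.ncPrePoisson.compat₃ x v u)
      + sum_leg₂_congr k S (fun u v => h.ncPrePoisson.compat₁ v x u)
      + sum_leg₂_congr k S (fun u v => h.ncPrePoisson.compat₁ x v u)
      + sum_leg₁_congr k S (fun u v => h.ncPrePoisson.compat₂ v u x)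
      + sum_leg₁_congr k S (fun u v => h.ncPrePoisson.compat₁ u v x)
  on_goal 7 =>
    linear_combination (norm := skip)
      -DFunLike.congr_arg (onLeg₃ (t x)) hD₂₃₁
      + DFunLike.congr_arg (onLeg₃ (t.flip x)) hD₂₃₁
      - DFunLike.congr_arg (onLeg₂ (s x)) hS
      + DFunLike.congr_arg (onLeg₁ (p.flip x)) hS
      - sum_leg₃_congr k S (fun u v => h.coherent x u v)
      + sum_leg₃_congr k S (fun u v => h.coherent v u x)
      - sum_leg₃_congr k S (fun u v => h.ncPrePoisson.compat₃ u v x)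
      - sum_leg₃_congr k S (fun u v => h.ncPrePoisson.compat₂ x u v)
      - sum_leg₃_congr k S (fun u v => h.ncPrePoisson.compat₁ v u x)
      - sum_leg₃_congr k S (fun u v => h.ncPrePoisson.compat₃ v u x)
      - sum_leg₃_congr k S (fun u v => h.ncPrePoisson.compat₂ x v u)
      - sum_leg₃_congr k S (fun u v => h.ncPrePoisson.compat₁ u v x)
      - sum_leg₂_congr k S (fun u v => h.ncPrePoisson.compat₃ x u v)
      - sum_leg₃_congr k S (fun u v => h.ncPrePoisson.compat₃ v x u)
      - sum_leg₃_congr k S (fun u v => h.ncPrePoisson.compat₁ x v u)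
      - sum_leg₃_congr k S (fun u v => h.ncPrePoisson.compat₁ v x u)
      + sum_leg₃_congr k S (fun u v => h.coherent x v u)
      - sum_leg₃_congr k S (fun u v => h.ncPrePoisson.compat₃ x v u)
      - sum_leg₃_congr k S (fun u v => h.ncPrePoisson.compat₂ u v x)
      - sum_leg₃_congr k S (fun u v => h.ncPrePoisson.compat₂ u x v)
      - sum_leg₁_congr k S (fun u v => h.ncPrePoisson.compat₃ u x v)
  on_goal 8 =>
    linear_combination (norm := skip)
      -DFunLike.congr_arg (onLeg₃ (t x)) hD₂₃₁
      + DFunLike.congr_arg (onLeg₃ (t.flip x)) hD₂₃₁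
      - DFunLike.congr_arg (onLeg₁ (t x)) hD₂₃₁
      - DFunLike.congr_arg (onLeg₂ (t x)) hD₂₃₁
      + sum_leg₁_congr k S (fun u v => h.ncPrePoisson.compat₁ x u v)
      + sum_leg₂_congr k S (fun u v => h.ncPrePoisson.compat₂ v x u)
      - sum_leg₃_congr k S (fun u v => h.ncPrePoisson.compat₃ u v x)
      - sum_leg₃_congr k S (fun u v => h.ncPrePoisson.compat₁ x u v)
      - sum_leg₃_congr k S (fun u v => h.ncPrePoisson.compat₂ u x v)
  all_goals
    simp only [coboundarySucc_eq hsymm, coboundaryPrec_eq, coboundaryStar_eq, dExpr, sExpr,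
      leg23_12, LinearMap.add_apply, LinearMap.sub_apply,
      LinearMap.comp_apply, LinearMap.flip_apply, map_add, map_sub, map_zero,
      leftIter_add_left, leftIter_sub_left, leftIter_add_right, leftIter_sub_right,
      rightIter_add_left, rightIter_sub_left, rightIter_add_right, rightIter_sub_right,
      leftIter_cob, rightIter_cob, swap12_onLeg, swap23_onLeg, swap12_leg12_13,
      swap12_leg12_23, swap12_leg13_23, swap23_leg12_13, swap23_leg12_23, swap23_leg13_23,
      hsymm]
    -- Only now is `r` written as a finite sum: the permutation rules above need `tau r = r` for `r`
    -- as a whole.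
    simp only [hr, leg12_13_sum, leg12_23_sum, leg13_23_sum]
    simp only [map_sum, onLeg₁, onLeg₂, onLeg₃, comm,
      LinearMap.rTensor_tmul, LinearMap.lTensor_tmul, LinearMap.add_apply, LinearMap.sub_apply,
      LinearMap.comp_apply, LinearMap.flip_apply, map_add, map_sub, TensorProduct.add_tmul,
      TensorProduct.sub_tmul, TensorProduct.tmul_add, TensorProduct.tmul_sub,
      Finset.sum_add_distrib, Finset.sum_sub_distrib]
    module

/-! ### Compatibility conditions, from symmetry alone. -/

set_option maxHeartbeats 2000000 in
theorem coboundary_isNCPrePoissonBialgebra (h : IsCoherentNCPrePoisson s p t)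
    (hsymm : tau r = r) (hr : IsNPPYBESolution s p t r) :
    IsNCPrePoissonBialgebra s p t (coboundarySucc s p r) (coboundaryPrec s p r)
      (coboundaryStar t r) := by
  have hd := h.ncPrePoisson.dendriform
  have hl := h.ncPrePoisson.preLie
  have hC := coboundary_isCoherentNCPrePoissonCoalgebra h hsymm hr.d_eq hr.s_eq
  refine ⟨h, hC, ⟨hd, hC.ncPrePoisson.dendriform, ?_, ?_, ?_, ?_, ?_, ?_⟩,
    ⟨hl, hC.ncPrePoisson.preLie, ?_, ?_⟩, ?_, ?_, ?_, ?_⟩ <;> intro x y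
  all_goals
    simp only [LinearMap.sub_apply, LinearMap.add_apply, LinearMap.comp_apply,
      coboundarySucc_apply hsymm, coboundaryPrec_apply,
      coboundaryStar_apply,
      map_sub, map_add, tau_onFst, tau_onSnd, hsymm]
    -- With the flips gone the goal is linear in `r`. The facts dropped here do not pass to the
    -- summands of `r`, so the induction must run without them.
    clear hC hr hsymm
    induction r with
    | zero => simp
    | add z w hz hw => simp only [map_add]; linear_combination (norm := module) hz + hw
    | tmul a b => ?_
  on_goal 1 =>
    linear_combination (norm := skip)
      tmul_congr_left k (hd.succ_succ a x y) b
      - tmul_congr_left k (hd.prec_prec a x y) b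
      + tmul_congr_right k a (hd.succ_succ x y b)
      - tmul_congr_left k (hd.succ_prec a x y) b
  on_goal 2 =>
    linear_combination (norm := skip)
      tmul_congr_right k a (hd.succ_prec x y b)
      + tmul_congr_left k (hd.prec_prec a x y) b
      - tmul_congr_right k a (hd.succ_succ x y b)
      + tmul_congr_right k a (hd.prec_prec x y b)
  on_goal 3 =>
    linear_combination (norm := skip)
      -tmul_congr_left k (hd.succ_prec a x y) b
      + tmul_congr_right k a (hd.prec_prec x y b)
  on_goal 4 =>
    linear_combination (norm := skip)
      tmul_congr_right k a (hd.succ_prec x y b)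
      + tmul_congr_left k (hd.succ_succ a x y) b
  on_goal 5 =>
    linear_combination (norm := skip)
      tmul_congr_left k (hd.succ_succ x a y) b
      - tmul_congr_left k (hd.prec_prec x a y) b
      + tmul_congr_right k a (hd.succ_prec y b x)
      - tmul_congr_left k (hd.succ_prec x a y) b
  on_goal 6 =>
    linear_combination (norm := skip)
      tmul_congr_left k (hd.succ_succ x a y) b
      - tmul_congr_right k a (hd.prec_prec y b x)
  on_goal 7 =>
    linear_combination (norm := skip)
      tmul_congr_right k a (hl.left_symm b x y)
      - tmul_congr_right k a (hl.left_symm b y x)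
      + tmul_congr_right k a (hl.left_symm x y b)
      + tmul_congr_left k (hl.left_symm x y a) b
  on_goal 8 =>
    linear_combination (norm := skip)
      tmul_congr_right k a (hl.left_symm b x y)
      - tmul_congr_left k (hl.left_symm a x y) b
  on_goal 9 =>
    linear_combination (norm := skip)
      tmul_congr_right k a (h.ncPrePoisson.compat₂ y x b)
      + tmul_congr_left k (h.ncPrePoisson.compat₁ x a y) b
  on_goal 10 =>
    linear_combination (norm := skip)
      -tmul_congr_left k (h.coherent x a y) b
      + tmul_congr_right k a (h.ncPrePoisson.compat₂ y b x)
  on_goal 11 =>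
    linear_combination (norm := skip)
      tmul_congr_right k a (h.ncPrePoisson.compat₁ b x y)
      + tmul_congr_right k a (h.ncPrePoisson.compat₃ x y b)
      + tmul_congr_right k a (h.ncPrePoisson.compat₂ x b y)
      + tmul_congr_left k (h.coherent x y a) b
  on_goal 12 =>
    linear_combination (norm := skip)
      tmul_congr_left k (h.ncPrePoisson.compat₁ x a y) b
      + tmul_congr_left k (h.ncPrePoisson.compat₂ a x y) b
      - tmul_congr_right k a (h.ncPrePoisson.compat₁ x y b)
      + tmul_congr_left k (h.ncPrePoisson.compat₃ a y x) b
  all_goals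
    simp only [onFst, onSnd, comm, LinearMap.rTensor_tmul, LinearMap.lTensor_tmul,
      LinearMap.add_apply, LinearMap.sub_apply, LinearMap.flip_apply, map_add, map_sub,
      TensorProduct.add_tmul, TensorProduct.sub_tmul, TensorProduct.tmul_add,
      TensorProduct.tmul_sub]
    module

end Coboundary

end NPPoisson

theorem mainTheorem3 {k A : Type*} [Field k] [AddCommGroup A] [Module k A] [FiniteDimensional k A]
    (s p t : A →ₗ[k] A →ₗ[k] A) (hA : NPPoisson.IsCoherentNCPrePoisson s p t)
    (r : A ⊗[k] A) (hsymm : NPPoisson.tau r = r) (hr : NPPoisson.IsNPPYBESolution s p t r) :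
    NPPoisson.IsNCPrePoissonBialgebra s p t (NPPoisson.coboundarySucc s p r)
      (NPPoisson.coboundaryPrec s p r) (NPPoisson.coboundaryStar t r) := by
  exact NPPoisson.coboundary_isNCPrePoissonBialgebra hA hsymm hr
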